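/- Let $\mathbb D$ be the open unit disk in $\mathbb C$. Let $g$ be analytic and univalent in $\mathbb D$ with convex image $g(\mathbb D)$, and let $f(z)=\sum_{n\ge 0}a_nz^n$ be analytic in $\mathbb D$ and subordinate to $g$, that is, $f=g\circ\omega$ for some analytic $\omega:\mathbb D\to\mathbb D$ with $\omega(0)=0$. Let $\lambda=\operatorname{dist}(g(0),\partial g(\mathbb D))$ and, for $0\le r<1$, $$T_f(r)=\sum_{n=1}^\infty|a_n|r^n+\left(\frac1{2-\lambda}+\frac r{1-r}\right)\sum_{n=1}^\infty|a_n|^2r^{2n}.$$ Let $r_*\approx 0.24683$ be the unique root of $3r^3-5r^2-3r+1=0$ in $(0,1)$. (a) If $\lambda\le 1$, then $T_f(r)\le\lambda$ for all $r\in[0,r_*]$. (b) For each $\lambda\in(0,1)$ the equation $$4r^3\lambda^2-(7r^3+3r^2-3r+1)\lambda+6r^3-2r^2-6r+2=0$$ has exactly one solution $r_0=r_0(\lambda)$ in $(r_*,\tfrac13)$, and $T_f(r)\le\lambda$ for all $r\in[0,r_0]$ and all $f,g$ as above with $\operatorname{dist}(g(0),\partial g(\mathbb D))=\lambda$. The radii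 are sharp: for each $r\in(r_*,1)$ there are $f,g$ as above with $\lambda\le1$ and $T_f(r)>\lambda$; and for each $\lambda\in(0,1)$ and $r\in(r_0(\lambda),1)$ there are $f,g$ as above with $\operatorname{dist}(g(0),\partial g(\mathbb D))=\lambda$ and $T_f(r)>\lambda$. -/

import Mathlib

open Metric Set

/-- `a` is the sequence of Taylor coefficients at `0` of `f`, analytic in the open unit disk:
`f z = ∑ a n * z ^ n` for `‖z‖ < 1`. (Hence all the series in `refinedBohrSum` below
converge for `0 ≤ r < 1`.) -/
def HasTaylorCoeffs (f : ℂ → ℂ) (a : ℕ → ℂ) : Prop :=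
  ∀ z ∈ ball (0 : ℂ) 1, HasSum (fun n : ℕ => a n * z ^ n) (f z)

/-- `g` is analytic and injective (univalent) in the open unit disk, with convex image. -/
structure IsConvexUnivalent (g : ℂ → ℂ) : Prop where
  analytic : DifferentiableOn ℂ g (ball 0 1)
  univalent : InjOn g (ball 0 1)
  convex_image : Convex ℝ (g '' ball 0 1)

/-- Subordination `f ≺ g` in the open unit disk: `f = g ∘ ω` there, for an analytic self-map
`ω` of the disk with `ω 0 = 0`. -/
def IsSubordinate (f g : ℂ → ℂ) : Prop :=
  ∃ ω : ℂ → ℂ, DifferentiableOn ℂ ω (ball 0 1) ∧ ω 0 = 0 ∧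
    MapsTo ω (ball 0 1) (ball 0 1) ∧ ∀ z ∈ ball (0 : ℂ) 1, f z = g (ω z)

/-- The Euclidean distance from `g 0` to the boundary of the image of the open unit disk. -/
noncomputable def boundaryDist (g : ℂ → ℂ) : ℝ :=
  infDist (g 0) (frontier (g '' ball 0 1))

/-- `‖f₀‖_r = ∑_{n ≥ 1} |a n|² r ^ (2 n)`. -/
noncomputable def quadSum (a : ℕ → ℂ) (r : ℝ) : ℝ :=
  ∑' n : ℕ, ‖a (n + 1)‖ ^ 2 * r ^ (2 * (n + 1))

/-- `T_f(r) = ∑_{n ≥ 1} |a n| r ^ n + (1 / (2 - l) + r / (1 - r)) ‖f₀‖_r`. -/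
noncomputable def refinedBohrSum (a : ℕ → ℂ) (l r : ℝ) : ℝ :=
  (∑' n : ℕ, ‖a (n + 1)‖ * r ^ (n + 1)) + (1 / (2 - l) + r / (1 - r)) * quadSum a r

/-- The polynomial `Φ(l, r)` whose zero in `r` is the radius belonging to `l`. -/
def radiusPoly (l r : ℝ) : ℝ :=
  4 * r ^ 3 * l ^ 2 - (7 * r ^ 3 + 3 * r ^ 2 - 3 * r + 1) * l
    + 6 * r ^ 3 - 2 * r ^ 2 - 6 * r + 2

/-! Let `p` be the boundary point of the convex domain nearest to `g 0`. A supporting line at `p`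
gives `c ≠ 0` for which `c * (p - f z)` has nonnegative real part on the disk. Carathéodory's
inequality, whose right side is at most `2 * ‖c‖ * λ`, then gives `‖a n‖ ≤ 2 * λ` for every `n ≥ 1`
(`norm_coeff_le_two_mul_boundaryDist`). A nearest point exists because the image is not the whole
plane (`IsConvexUnivalent.image_ne_univ`).

The sum `T_f(r)` is monotone in each `‖a n‖`, so it is at most `λ * halfPlaneRatio λ r`, its value
for the half-plane map `2λz/(1 - z)`, all of whose coefficients with `n ≥ 1` equal `2λ`. Both the
inequality and its sharpness thus depend only on whether `halfPlaneRatio λ r ≤ 1`. Clearing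
denominators turns this into `0 ≤ radiusPoly λ r`. Since the ratio increases strictly in `r`, a root
of the polynomial in `[0, 1)` is unique and separates the good radii from the bad ones. -/

/-! ### Fourier coefficients on circles and Carathéodory's inequality. -/

/-- The integral over a circle of a power series against a character, term by term. -/
theorem hasSum_integral_powerSeries_mul_exp {f : ℂ → ℂ} {a : ℕ → ℂ} (hf : HasTaylorCoeffs f a)
    {ρ : ℝ} (h0 : 0 < ρ) (h1 : ρ < 1) (k : ℤ) :
    HasSum (fun m : ℕ => if (m : ℤ) + k = 0 then 2 * Real.pi * (a m * (ρ : ℂ) ^ m) else 0)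
      (∫ t in (0 : ℝ)..2 * Real.pi, f (ρ * Complex.exp (t * Complex.I)) *
        Complex.exp (k * (t * Complex.I))) := by
  have hmem : ∀ t : ℝ, (ρ : ℂ) * Complex.exp (t * Complex.I) ∈ ball (0 : ℂ) 1 := fun t => by
    simp [Complex.norm_exp_ofReal_mul_I, abs_of_pos h0, h1]
  have hsum : Summable fun m : ℕ => ‖a m‖ * ρ ^ m := by
    have h : (ρ : ℂ) ∈ ball (0 : ℂ) 1 := by simp [abs_of_pos h0, h1]
    simpa [abs_of_pos h0] using (hf _ h).summable.norm
  have key : ∀ (m : ℕ) (t : ℝ), a m * ((ρ : ℂ) * Complex.exp (t * Complex.I)) ^ m *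
      Complex.exp (k * (t * Complex.I)) =
      (a m * (ρ : ℂ) ^ m) * Complex.exp ((((m : ℤ) + k : ℤ) * Complex.I) * t) := by
    intro m t
    rw [mul_pow, ← Complex.exp_nat_mul, mul_assoc, mul_assoc, mul_assoc, ← Complex.exp_add]
    congr 3
    push_cast
    ring_nf
  have hint : ∀ j : ℤ, ∫ t in (0 : ℝ)..2 * Real.pi, Complex.exp ((j * Complex.I) * t) =
      if j = 0 then 2 * Real.pi else 0 := by
    intro j
    split_ifs with hj
    · simp [hj]
    · rw [integral_exp_mul_complex (by simp [hj])]
      have : Complex.exp (j * Complex.I * ((2 * Real.pi : ℝ) : ℂ)) = 1 := by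
        rw [← Complex.exp_int_mul_two_pi_mul_I j]
        congr 1
        push_cast
        ring
      rw [this]
      simp
  have main := intervalIntegral.hasSum_integral_of_dominated_convergence
    (μ := MeasureTheory.volume) (a := 0) (b := 2 * Real.pi)
    (F := fun (m : ℕ) (t : ℝ) => a m * ((ρ : ℂ) * Complex.exp (t * Complex.I)) ^ m *
      Complex.exp (k * (t * Complex.I)))
    (f := fun t : ℝ => f (ρ * Complex.exp (t * Complex.I)) * Complex.exp (k * (t * Complex.I)))
    (fun m _ => ‖a m‖ * ρ ^ m)
    (fun m => Continuous.aestronglyMeasurable (by fun_prop))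
    (fun m => Filter.Eventually.of_forall fun t _ => by
      rw [key]
      have : ((((m : ℤ) + k : ℤ) : ℂ) * Complex.I) * (t : ℂ) =
          ((((m : ℤ) + k : ℤ) * t : ℝ) : ℂ) * Complex.I := by push_cast; ring
      rw [this, norm_mul, Complex.norm_exp_ofReal_mul_I]
      simp [abs_of_pos h0])
    (Filter.Eventually.of_forall fun _ _ => hsum)
    intervalIntegrable_const
    (Filter.Eventually.of_forall fun t _ => (hf _ (hmem t)).mul_right _)
  refine (congrArg (HasSum · _) (funext fun m => ?_)).mpr main
  simp only [key]
  rw [intervalIntegral.integral_const_mul, hint]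
  split_ifs <;> simp [mul_comm]

/-- **Carathéodory's inequality** for the coefficients of a function with nonnegative real part. -/
theorem HasTaylorCoeffs.norm_coeff_le_of_re_nonneg {f : ℂ → ℂ} {a : ℕ → ℂ}
    (hf : HasTaylorCoeffs f a) (hc : ContinuousOn f (ball 0 1))
    (hre : ∀ z ∈ ball (0 : ℂ) 1, 0 ≤ (f z).re)
    {n : ℕ} (hn : n ≠ 0) : ‖a n‖ ≤ 2 * (a 0).re := by
  have bound : ∀ ρ ∈ Ioo (0 : ℝ) 1, ‖a n‖ * ρ ^ n ≤ 2 * (a 0).re := by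
    intro ρ ⟨h0, h1⟩
    have hmem : ∀ t : ℝ, (ρ : ℂ) * Complex.exp (t * Complex.I) ∈ ball (0 : ℂ) 1 := fun t => by
      simp [Complex.norm_exp_ofReal_mul_I, abs_of_pos h0, h1]
    have hcont : Continuous fun t : ℝ => f (ρ * Complex.exp (t * Complex.I)) :=
      hc.comp_continuous (by fun_prop) hmem
    set F : ℝ → ℂ := fun t => f (ρ * Complex.exp (t * Complex.I))
    have e1 : ∫ t in (0 : ℝ)..2 * Real.pi, F t * Complex.exp ((-n : ℤ) * (t * Complex.I)) =
        2 * Real.pi * (a n * (ρ : ℂ) ^ n) := by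
      refine (hasSum_integral_powerSeries_mul_exp hf h0 h1 (-n)).unique ?_
      convert hasSum_ite_eq n (2 * (Real.pi : ℂ) * (a n * (ρ : ℂ) ^ n)) using 2 with m
      by_cases h : m = n
      · simp [h]
      · rw [if_neg h, if_neg (by omega)]
    have e2 : ∫ t in (0 : ℝ)..2 * Real.pi, F t * Complex.exp ((n : ℤ) * (t * Complex.I)) = 0 := by
      refine (hasSum_integral_powerSeries_mul_exp hf h0 h1 n).unique ?_
      convert hasSum_zero using 2 with m
      rw [if_neg (by omega)]
    have e3 : ∫ t in (0 : ℝ)..2 * Real.pi, F t = 2 * Real.pi * a 0 := by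
      have := (hasSum_integral_powerSeries_mul_exp hf h0 h1 0).unique (by
        convert hasSum_ite_eq 0 (2 * (Real.pi : ℂ) * a 0) using 2 with m
        by_cases h : m = 0
        · simp [h]
        · rw [if_neg h, if_neg (by omega)])
      simpa using this
    -- Conjugating the vanishing positive-frequency integral shows that conj `F` contributes nothing
    -- at frequency `-n`. So `F` may be replaced by `2 * re F`, whose absolute value integrates to a
    -- multiple of `re (a 0)`.
    have e2' : ∫ t in (0 : ℝ)..2 * Real.pi,
        (starRingEnd ℂ) (F t) * Complex.exp ((-n : ℤ) * (t * Complex.I)) = 0 := by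
      have h := congrArg (starRingEnd ℂ) e2
      rw [← intervalIntegral.intervalIntegral_conj, map_zero] at h
      rw [← h]
      congr 1 with t
      rw [map_mul, ← Complex.exp_conj]
      simp
    have e4 : ∫ t in (0 : ℝ)..2 * Real.pi,
        (((2 * (F t).re : ℝ) : ℂ) * Complex.exp ((-n : ℤ) * (t * Complex.I))) =
        2 * Real.pi * (a n * (ρ : ℂ) ^ n) := by
      have i1 : IntervalIntegrable (fun t : ℝ => F t * Complex.exp ((-n : ℤ) * (t * Complex.I)))
          MeasureTheory.volume 0 (2 * Real.pi) :=
        (hcont.mul (by fun_prop)).intervalIntegrable _ _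
      have i2 : IntervalIntegrable (fun t : ℝ => (starRingEnd ℂ) (F t) *
          Complex.exp ((-n : ℤ) * (t * Complex.I))) MeasureTheory.volume 0 (2 * Real.pi) :=
        ((Complex.continuous_conj.comp hcont).mul (by fun_prop)).intervalIntegrable _ _
      rw [← add_zero (2 * Real.pi * (a n * (ρ : ℂ) ^ n)), ← e1, ← e2',
        ← intervalIntegral.integral_add i1 i2]
      congr 1 with t
      rw [← add_mul, Complex.add_conj]
    have e5 : ∫ t in (0 : ℝ)..2 * Real.pi, 2 * (F t).re = 2 * (2 * Real.pi * (a 0).re) := by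
      rw [intervalIntegral.integral_const_mul]
      have h := Complex.reCLM.intervalIntegral_comp_comm (μ := MeasureTheory.volume)
        (hcont.intervalIntegrable 0 (2 * Real.pi))
      simp only [Complex.reCLM_apply] at h
      rw [h, e3]
      simp
    have h6 := intervalIntegral.norm_integral_le_integral_norm (μ := MeasureTheory.volume)
      (f := fun t : ℝ => ((2 * (F t).re : ℝ) : ℂ) * Complex.exp ((-n : ℤ) * (t * Complex.I)))
      Real.two_pi_pos.le
    rw [e4] at h6
    have h7 : ∫ t in (0 : ℝ)..2 * Real.pi,
        ‖((2 * (F t).re : ℝ) : ℂ) * Complex.exp ((-n : ℤ) * (t * Complex.I))‖ =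
        ∫ t in (0 : ℝ)..2 * Real.pi, 2 * (F t).re := by
      congr 1 with t
      have h9 : (((-n : ℤ) : ℂ)) * (t * Complex.I) = (((-n : ℤ) * t : ℝ) : ℂ) * Complex.I := by
        push_cast; ring
      rw [norm_mul, h9, Complex.norm_exp_ofReal_mul_I, mul_one, Complex.norm_real,
        Real.norm_of_nonneg (mul_nonneg two_pos.le (hre _ (hmem t)))]
    rw [h7, e5] at h6
    have h8 : ‖2 * (Real.pi : ℂ) * (a n * (ρ : ℂ) ^ n)‖ = 2 * Real.pi * (‖a n‖ * ρ ^ n) := by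
      simp [abs_of_pos h0, abs_of_pos Real.pi_pos]
    rw [h8] at h6
    have := Real.two_pi_pos
    nlinarith
  -- `f` need not extend to the unit circle, so the estimate is made on radius `ρ < 1` and `ρ` tends
  -- to `1`.
  have lim : Filter.Tendsto (fun ρ : ℝ => ‖a n‖ * ρ ^ n) (nhdsWithin 1 (Iio 1))
      (nhds (‖a n‖ * 1 ^ n)) :=
    (Continuous.tendsto (by fun_prop) 1).mono_left nhdsWithin_le_nhds
  rw [one_pow, mul_one] at lim
  exact le_of_tendsto lim (Filter.eventually_of_mem (Ioo_mem_nhdsLT one_pos) bound)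

/-! ### The image is open and is not the whole plane. -/

theorem IsConvexUnivalent.isOpenMapOn {g : ℂ → ℂ} (hg : IsConvexUnivalent g) :
    ∀ s ⊆ ball (0 : ℂ) 1, IsOpen s → IsOpen (g '' s) := by
  refine ((hg.analytic.analyticOnNhd isOpen_ball).is_constant_or_isOpen
    (convex_ball (0 : ℂ) 1).isPreconnected).resolve_left ?_
  rintro ⟨w, hw⟩
  have h0 : (0 : ℂ) ∈ ball (0 : ℂ) 1 := by simp
  have h1 : (1 / 2 : ℂ) ∈ ball (0 : ℂ) 1 := by norm_num
  have := hg.univalent h0 h1 ((hw _ h0).trans (hw _ h1).symm)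
  norm_num at this

/-- The unit disk is not conformally equivalent to the plane. -/
theorem IsConvexUnivalent.image_ne_univ {g : ℂ → ℂ} (hg : IsConvexUnivalent g) :
    g '' ball 0 1 ≠ univ := by
  intro huniv
  obtain ⟨z₀, hz₀, hd⟩ : ∃ z₀ ∈ ball (0 : ℂ) 1, deriv g z₀ ≠ 0 := by
    by_contra! hcon
    have h0 : (0 : ℂ) ∈ ball (0 : ℂ) 1 := by simp
    have h1 : (1 / 2 : ℂ) ∈ ball (0 : ℂ) 1 := by norm_num
    have := hg.univalent h0 h1 (isOpen_ball.is_const_of_deriv_eq_zero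
      (convex_ball (0 : ℂ) 1).isPreconnected hg.analytic hcon h0 h1)
    norm_num at this
  have hcont : Continuous ((ball (0 : ℂ) 1).domRestrict g) :=
    hg.analytic.continuousOn.domRestrict
  have hinj : Function.Injective ((ball (0 : ℂ) 1).domRestrict g) := hg.univalent.injective
  have hopen : IsOpenMap ((ball (0 : ℂ) 1).domRestrict g) := by
    intro s hs
    rw [show (ball (0 : ℂ) 1).domRestrict g '' s = g '' (Subtype.val '' s) by
      rw [image_image]; rfl]
    exact hg.isOpenMapOn _ (by simp) (isOpen_ball.isOpenMap_subtype_val s hs)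
  have hemb := Topology.IsOpenEmbedding.of_continuous_injective_isOpenMap hcont hinj hopen
  -- If `g` is onto the plane it is a homeomorphism, hence proper: preimages of closed discs are
  -- compact in the open disk.
  have hcl : Topology.IsClosedEmbedding ((ball (0 : ℂ) 1).domRestrict g) :=
    ⟨hemb.toIsEmbedding, by rw [range_domRestrict, huniv]; exact isClosed_univ⟩
  have hk : DifferentiableOn ℂ (dslope g z₀) (ball 0 1) :=
    (Complex.differentiableOn_dslope (isOpen_ball.mem_nhds hz₀)).mpr hg.analytic
  have hk0 : ∀ z ∈ ball (0 : ℂ) 1, dslope g z₀ z ≠ 0 := by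
    intro z hz
    rcases eq_or_ne z z₀ with rfl | hne
    · simpa using hd
    · rw [dslope_of_ne _ hne, slope_def_field]
      exact div_ne_zero (sub_ne_zero.2 fun h => hne (hg.univalent hz hz₀ h)) (sub_ne_zero.2 hne)
  -- The difference quotient at `z₀` has no zeros, so the maximum principle applies to its
  -- reciprocal. On a circle enclosing the preimage of the disc of radius `R`, the reciprocal is at
  -- most `2 / R`. Its value at `z₀` is `1 / g'(z₀)`, which large `R` forces to vanish.
  have bound : ∀ R : ℝ, 0 < R → ‖(deriv g z₀)⁻¹‖ ≤ 2 / R := by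
    intro R hR
    have hK := (hcl.isCompact_preimage (isCompact_closedBall (g z₀) R)).image continuous_subtype_val
    obtain ⟨x, hx, hmax⟩ := hK.exists_isMaxOn (f := fun z : ℂ => ‖z‖)
      ⟨z₀, ⟨z₀, hz₀⟩, mem_closedBall_self hR.le, rfl⟩ continuous_norm.continuousOn
    obtain ⟨⟨x, hx1⟩, -, rfl⟩ := hx
    rw [mem_ball_zero_iff] at hx1
    obtain ⟨ρ, hρ1, hρ2⟩ := exists_between hx1
    have hρ0 : 0 < ρ := (norm_nonneg _).trans_lt hρ1
    have hsub : closedBall (0 : ℂ) ρ ⊆ ball 0 1 := closedBall_subset_ball hρ2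
    have hfar : ∀ z ∈ ball (0 : ℂ) 1, ρ ≤ ‖z‖ → R < ‖g z - g z₀‖ := by
      intro z hz hzρ
      by_contra! hle
      have : ‖z‖ ≤ ‖x‖ := hmax ⟨⟨z, hz⟩, mem_closedBall_iff_norm.2 hle, rfl⟩
      linarith
    have hz₀ρ : z₀ ∈ ball (0 : ℂ) ρ := by
      rw [mem_ball_zero_iff]
      by_contra! hle
      have := hfar z₀ hz₀ hle
      simp at this
      linarith
    have hdiff : DiffContOnCl ℂ (fun z => (dslope g z₀ z)⁻¹) (ball 0 ρ) := by
      refine DifferentiableOn.diffContOnCl ?_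
      rw [closure_ball _ hρ0.ne']
      exact (hk.mono hsub).inv fun z hz => hk0 z (hsub hz)
    have := Complex.norm_le_of_forall_mem_frontier_norm_le (C := 2 / R) isBounded_ball hdiff
      (fun z hz => ?_) (subset_closure hz₀ρ)
    · simpa using this
    · rw [frontier_ball _ hρ0.ne', mem_sphere_zero_iff_norm] at hz
      have hzb : z ∈ ball (0 : ℂ) 1 := by rw [mem_ball_zero_iff, hz]; exact hρ2
      have hne : z ≠ z₀ := by
        rintro rfl
        rw [mem_ball_zero_iff] at hz₀ρ
        linarith
      have h2 : ‖z - z₀‖ ≤ 2 := by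
        rw [mem_ball_zero_iff] at hzb hz₀
        linarith [norm_sub_le z z₀]
      have h3 := hfar z hzb hz.ge
      rw [dslope_of_ne _ hne, slope_def_field, inv_div, norm_div]
      gcongr
  have hpos : 0 < ‖(deriv g z₀)⁻¹‖ := norm_pos_iff.2 (inv_ne_zero hd)
  have := bound (4 / ‖(deriv g z₀)⁻¹‖) (by positivity)
  rw [div_div_eq_mul_div] at this
  linarith

/-! ### The extremal half-plane map. -/

/-- The map of the unit disk onto the half-plane `{w | -l < re w}`. -/
noncomputable def halfPlaneMap (l : ℝ) (z : ℂ) : ℂ := 2 * l * z / (1 - z)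

theorem one_sub_ne_zero_of_mem_ball {z : ℂ} (hz : z ∈ ball (0 : ℂ) 1) : 1 - z ≠ 0 := by
  intro h
  rw [sub_eq_zero] at h
  simp [← h] at hz

/-- Adding `l` turns the map into `l * (1 + z) / (1 - z)`, whose real part is `l` times the Poisson
kernel; its positivity puts the image in the half-plane. -/
theorem halfPlaneMap_re_add {l : ℝ} {z : ℂ} (hz : 1 - z ≠ 0) :
    (halfPlaneMap l z).re + l = l * (1 - ‖z‖ ^ 2) / ‖1 - z‖ ^ 2 := by
  have h : ‖1 - z‖ ^ 2 ≠ 0 := by simpa using hz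
  have e : halfPlaneMap l z + l = l * (1 + z) / (1 - z) := by
    rw [halfPlaneMap]; field_simp; ring
  have e' : (halfPlaneMap l z).re + l = (l * (1 + z) / (1 - z)).re := by
    rw [← e]; simp
  rw [e', Complex.div_re, Complex.sq_norm, Complex.sq_norm]
  rw [Complex.sq_norm] at h
  field_simp
  simp [Complex.normSq_apply]
  ring

theorem halfPlaneMap_image {l : ℝ} (hl : 0 < l) :
    halfPlaneMap l '' ball 0 1 = {w : ℂ | -l < w.re} := by
  have hlc : (l : ℂ) ≠ 0 := by exact_mod_cast hl.ne'
  ext w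
  constructor
  · rintro ⟨z, hz, rfl⟩
    have h := one_sub_ne_zero_of_mem_ball hz
    have h2 := halfPlaneMap_re_add (l := l) h
    have h3 : 0 < ‖1 - z‖ := norm_pos_iff.2 h
    have h4 : ‖z‖ < 1 := by simpa using hz
    have : 0 < l * (1 - ‖z‖ ^ 2) / ‖1 - z‖ ^ 2 := by
      have : 0 < 1 - ‖z‖ ^ 2 := by nlinarith [norm_nonneg z]
      positivity
    change -l < _
    linarith
  · intro hw
    change -l < w.re at hw
    have hne : w + 2 * l ≠ 0 := by
      intro h
      have := congrArg Complex.re h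
      simp at this
      linarith
    have hz : 1 - w / (w + 2 * l) = 2 * l / (w + 2 * l) := by field_simp; ring
    refine ⟨w / (w + 2 * l), ?_, ?_⟩
    · rw [mem_ball_zero_iff, norm_div, div_lt_one (norm_pos_iff.2 hne)]
      rw [← sq_lt_sq₀ (norm_nonneg _) (norm_nonneg _), Complex.sq_norm, Complex.sq_norm,
        Complex.normSq_apply, Complex.normSq_apply]
      simp
      nlinarith
    · rw [halfPlaneMap, hz]
      field_simp

theorem isConvexUnivalent_halfPlaneMap {l : ℝ} (hl : 0 < l) :
    IsConvexUnivalent (halfPlaneMap l) where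
  analytic := by
    unfold halfPlaneMap
    exact DifferentiableOn.div (by fun_prop) (by fun_prop) fun z hz =>
      one_sub_ne_zero_of_mem_ball hz
  univalent := by
    intro z hz w hw h
    have hlc : (l : ℂ) ≠ 0 := by exact_mod_cast hl.ne'
    have h1 := one_sub_ne_zero_of_mem_ball hz
    have h2 := one_sub_ne_zero_of_mem_ball hw
    rw [halfPlaneMap, halfPlaneMap, div_eq_div_iff h1 h2] at h
    have : 2 * (l : ℂ) * (z - w) = 0 := by linear_combination h
    simpa [hlc, sub_eq_zero] using this
  convex_image := by
    rw [halfPlaneMap_image hl]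
    exact convex_halfSpace_re_gt _

theorem boundaryDist_halfPlaneMap {l : ℝ} (hl : 0 < l) : boundaryDist (halfPlaneMap l) = l := by
  have h0 : halfPlaneMap l 0 = 0 := by simp [halfPlaneMap]
  rw [boundaryDist, halfPlaneMap_image hl, Complex.frontier_setOfPred_lt_re, h0]
  have hmem : (-l : ℂ) ∈ {z : ℂ | z.re = -l} := by simp
  refine le_antisymm ?_ ?_
  · refine (infDist_le_dist_of_mem hmem).trans ?_
    simp [abs_of_pos hl]
  · refine (le_infDist ⟨_, hmem⟩).2 fun z hz => ?_
    have hz : z.re = -l := hz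
    rw [dist_zero_left]
    have := Complex.abs_re_le_norm z
    rwa [hz, abs_neg, abs_of_pos hl] at this

theorem hasTaylorCoeffs_halfPlaneMap (l : ℝ) :
    HasTaylorCoeffs (halfPlaneMap l) fun n => if n = 0 then 0 else 2 * (l : ℂ) := by
  intro z hz
  have hz1 : ‖z‖ < 1 := by simpa using hz
  have h := ((hasSum_geometric_of_norm_lt_one hz1).mul_left (2 * (l : ℂ) * z))
  have e : halfPlaneMap l z = 2 * l * z * (1 - z)⁻¹ := div_eq_mul_inv _ _
  rw [e, ← hasSum_nat_add_iff' 1]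
  simp only [Finset.range_one, Finset.sum_singleton, if_true, zero_mul, sub_zero]
  refine (congrArg (HasSum · _) (funext fun n => ?_)).mpr h
  rw [if_neg n.succ_ne_zero]
  ring

theorem isSubordinate_refl (g : ℂ → ℂ) : IsSubordinate g g :=
  ⟨id, differentiableOn_id, rfl, mapsTo_id _, fun _ _ => rfl⟩

/-! ### The extremal ratio as a function of the radius. -/

/-- `T_f(r) / l` for the half-plane map `f` with distance `l`. -/
noncomputable def halfPlaneRatio (l r : ℝ) : ℝ :=
  2 * (r / (1 - r)) + 4 * l * ((1 / (2 - l) + r / (1 - r)) * (r ^ 2 / (1 - r ^ 2)))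

theorem one_sub_halfPlaneRatio_mul {l r : ℝ} (hl : l < 2) (h0 : 0 ≤ r) (h1 : r < 1) :
    (1 - halfPlaneRatio l r) * ((2 - l) * (1 - r) ^ 2 * (1 + r)) = radiusPoly l r := by
  have e : 1 - r ^ 2 = (1 - r) * (1 + r) := by ring
  have a1 : 2 - l ≠ 0 := by linarith
  have a2 : 1 - r ≠ 0 := by linarith
  have a3 : 1 + r ≠ 0 := by linarith
  rw [halfPlaneRatio, radiusPoly, e]
  field_simp
  ring

/-- Strictness comes from `2 * (r / (1 - r))` alone, so `l = 0` is allowed; the other term is a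
product of nonnegative nondecreasing factors. -/
theorem strictMonoOn_halfPlaneRatio {l : ℝ} (h0 : 0 ≤ l) (h2 : l < 2) :
    StrictMonoOn (halfPlaneRatio l) (Ico 0 1) := by
  rintro x ⟨hx0, hx1⟩ y ⟨hy0, hy1⟩ hxy
  have e1 : x / (1 - x) < y / (1 - y) := by
    rw [div_lt_div_iff₀ (by linarith) (by linarith)]; nlinarith
  have hsq : x ^ 2 < y ^ 2 := by nlinarith
  have hy2 : y ^ 2 < 1 := by nlinarith
  have e2 : x ^ 2 / (1 - x ^ 2) ≤ y ^ 2 / (1 - y ^ 2) := by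
    rw [div_le_div_iff₀ (by linarith) (by linarith)]; nlinarith
  have p1 : 0 ≤ x / (1 - x) := div_nonneg hx0 (by linarith)
  have p2 : 0 ≤ x ^ 2 / (1 - x ^ 2) := div_nonneg (sq_nonneg _) (by linarith)
  have p3 : 0 < 1 / (2 - l) := by
    have : 0 < 2 - l := by linarith
    positivity
  have e3 : (1 / (2 - l) + x / (1 - x)) * (x ^ 2 / (1 - x ^ 2)) ≤
      (1 / (2 - l) + y / (1 - y)) * (y ^ 2 / (1 - y ^ 2)) :=
    mul_le_mul (by linarith) e2 p2 (by linarith)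
  have e4 := mul_le_mul_of_nonneg_left e3 (by linarith : 0 ≤ 4 * l)
  unfold halfPlaneRatio
  linarith

theorem hasSum_const_mul_pow_succ (c : ℝ) {r : ℝ} (h0 : 0 ≤ r) (h1 : r < 1) :
    HasSum (fun n : ℕ => c * r ^ (n + 1)) (c * (r / (1 - r))) := by
  refine HasSum.mul_left c ?_
  simpa [pow_succ', div_eq_mul_inv] using (hasSum_geometric_of_lt_one h0 h1).mul_left r

theorem hasSum_const_mul_sq_pow_succ (c : ℝ) {r : ℝ} (h0 : 0 ≤ r) (h1 : r < 1) :
    HasSum (fun n : ℕ => c * r ^ (2 * (n + 1))) (c * (r ^ 2 / (1 - r ^ 2))) := by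
  simpa only [pow_mul] using hasSum_const_mul_pow_succ c (sq_nonneg r) (by nlinarith)

theorem refinedBohrSum_eq_of_norm_eq {a : ℕ → ℂ} {l r : ℝ} (ha : ∀ n, ‖a (n + 1)‖ = 2 * l)
    (h0 : 0 ≤ r) (h1 : r < 1) : refinedBohrSum a l r = l * halfPlaneRatio l r := by
  simp only [refinedBohrSum, quadSum, ha]
  rw [(hasSum_const_mul_pow_succ _ h0 h1).tsum_eq, (hasSum_const_mul_sq_pow_succ _ h0 h1).tsum_eq,
    halfPlaneRatio]
  ring

/-- The weight of the quadratic sum is nonnegative when `l < 2`, so termwise comparison with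
geometric series suffices. -/
theorem refinedBohrSum_le_of_norm_le {a : ℕ → ℂ} {l r : ℝ} (hl : l < 2)
    (ha : ∀ n, ‖a (n + 1)‖ ≤ 2 * l) (h0 : 0 ≤ r) (h1 : r < 1) :
    refinedBohrSum a l r ≤ l * halfPlaneRatio l r := by
  have s1 := hasSum_const_mul_pow_succ (2 * l) h0 h1
  have s2 := hasSum_const_mul_sq_pow_succ ((2 * l) ^ 2) h0 h1
  have b1 : ∀ n, ‖a (n + 1)‖ * r ^ (n + 1) ≤ 2 * l * r ^ (n + 1) := fun n => by
    gcongr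
    exact ha n
  have b2 : ∀ n, ‖a (n + 1)‖ ^ 2 * r ^ (2 * (n + 1)) ≤ (2 * l) ^ 2 * r ^ (2 * (n + 1)) := fun n => by
    gcongr
    exact ha n
  have t1 := (s1.summable.of_nonneg_of_le (fun n => by positivity) b1).tsum_le_tsum b1 s1.summable
  have t2 := (s2.summable.of_nonneg_of_le (fun n => by positivity) b2).tsum_le_tsum b2 s2.summable
  rw [s1.tsum_eq] at t1
  rw [s2.tsum_eq] at t2
  have p : 0 ≤ 1 / (2 - l) + r / (1 - r) := by
    have : 0 < 2 - l := by linarith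
    have : 0 < 1 - r := by linarith
    positivity
  have t3 := mul_le_mul_of_nonneg_left t2 p
  unfold refinedBohrSum quadSum halfPlaneRatio
  linarith

/-! ### Coefficient bound by a supporting line. -/

/-- Coefficients of a function subordinate to a convex univalent function. -/
theorem norm_coeff_le_two_mul_boundaryDist {f g : ℂ → ℂ} {a : ℕ → ℂ} (hf : HasTaylorCoeffs f a)
    (hg : IsConvexUnivalent g) (hfg : IsSubordinate f g) (n : ℕ) :
    ‖a (n + 1)‖ ≤ 2 * boundaryDist g := by
  obtain ⟨ω, hω, hω0, hmaps, hcomp⟩ := hfg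
  have hb0 : (0 : ℂ) ∈ ball (0 : ℂ) 1 := by simp
  have hfd : DifferentiableOn ℂ f (ball 0 1) := (hg.analytic.comp hω hmaps).congr hcomp
  have ha0 : a 0 = g 0 := by
    have h1 := hf 0 hb0
    rw [hcomp 0 hb0, hω0] at h1
    refine HasSum.unique ?_ h1
    convert hasSum_ite_eq 0 (a 0) using 2 with m
    by_cases h : m = 0 <;> simp [h]
  have hopen : IsOpen (g '' ball 0 1) := hg.isOpenMapOn _ subset_rfl isOpen_ball
  have hne : (frontier (g '' ball (0 : ℂ) 1)).Nonempty :=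
    nonempty_frontier_iff.2 ⟨⟨_, mem_image_of_mem g hb0⟩, hg.image_ne_univ⟩
  obtain ⟨p, hp, hdist⟩ := isClosed_frontier.exists_infDist_eq_dist hne (g 0)
  have hpn : p ∉ g '' ball 0 1 := by
    rw [hopen.frontier_eq] at hp
    exact hp.2
  obtain ⟨L, hL⟩ := geometric_hahn_banach_open_point hg.convex_image hopen hpn
  -- Every real-linear functional on `ℂ` has the form `w ↦ re (c * w)`; this makes the separating
  -- functional a complex multiplier, which preserves power series.
  set c : ℂ := ⟨L 1, -L Complex.I⟩ with hc
  have hLc : ∀ w : ℂ, L w = (c * w).re := by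
    intro w
    have : w = w.re • (1 : ℂ) + w.im • Complex.I := by
      apply Complex.ext <;> simp
    have h := congrArg L this
    rw [map_add, map_smul, map_smul] at h
    rw [h]
    simp [hc]
    ring
  have hc0 : c ≠ 0 := by
    intro h
    have := hL _ (mem_image_of_mem g hb0)
    simp [hLc, h] at this
  have hcoef : HasTaylorCoeffs (fun z => c * (p - f z))
      (fun m => if m = 0 then c * (p - a 0) else -(c * a m)) := by
    intro z hz
    have h2 := ((hasSum_ite_eq (0 : ℕ) p).sub (hf z hz)).mul_left c
    refine (congrArg (HasSum · _) (funext fun m => ?_)).mpr h2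
    by_cases h : m = 0
    · simp [h]
    · simp [h]
      ring
  have key := hcoef.norm_coeff_le_of_re_nonneg
    (continuousOn_const.mul (continuousOn_const.sub hfd.continuousOn)) (fun z hz => by
      have := hL _ (mem_image_of_mem g (hmaps hz))
      rw [← hcomp z hz, hLc, hLc] at this
      rw [mul_sub, Complex.sub_re]
      linarith) n.succ_ne_zero
  simp only [Nat.succ_ne_zero, if_false, if_true, norm_neg, norm_mul, ha0] at key
  have h3 : (c * (p - g 0)).re ≤ ‖c‖ * boundaryDist g := by
    refine (Complex.re_le_norm _).trans ?_
    rw [norm_mul, boundaryDist, hdist, dist_comm, dist_eq_norm]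
  have h4 : 0 < ‖c‖ := norm_pos_iff.2 hc0
  refine le_of_mul_le_mul_left ?_ h4
  calc ‖c‖ * ‖a (n + 1)‖ ≤ 2 * (c * (p - g 0)).re := key
    _ ≤ ‖c‖ * (2 * boundaryDist g) := by linarith

/-! ### From the ratio to the radius polynomial, and sharpness. -/

theorem halfPlaneRatio_le_one_iff {l r : ℝ} (hl : l < 2) (h0 : 0 ≤ r) (h1 : r < 1) :
    halfPlaneRatio l r ≤ 1 ↔ 0 ≤ radiusPoly l r := by
  have hpos : 0 < (2 - l) * (1 - r) ^ 2 * (1 + r) := by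
    have : 0 < 2 - l := by linarith
    have : 0 < 1 - r := by linarith
    positivity
  rw [← one_sub_halfPlaneRatio_mul hl h0 h1, mul_nonneg_iff_of_pos_right hpos, sub_nonneg]

theorem halfPlaneRatio_eq_one_iff {l r : ℝ} (hl : l < 2) (h0 : 0 ≤ r) (h1 : r < 1) :
    halfPlaneRatio l r = 1 ↔ radiusPoly l r = 0 := by
  have hpos : (2 - l) * (1 - r) ^ 2 * (1 + r) ≠ 0 := by
    have : 0 < 2 - l := by linarith
    have : 0 < 1 - r := by linarith
    positivity
  rw [← one_sub_halfPlaneRatio_mul hl h0 h1, mul_eq_zero, or_iff_left hpos, sub_eq_zero, eq_comm]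

theorem radiusPoly_one (r : ℝ) : radiusPoly 1 r = 3 * r ^ 3 - 5 * r ^ 2 - 3 * r + 1 := by
  rw [radiusPoly]; ring

/-- The difference has the factor `1 - l` and a positive cofactor. Hence the radius for `l = 1`
serves every smaller distance, and each `l < 1` admits a strictly larger one. -/
theorem radiusPoly_one_lt {l r : ℝ} (hl : l < 1) (h0 : 0 ≤ r) (h1 : r < 1) :
    radiusPoly 1 r < radiusPoly l r := by
  have h2 : 0 < (1 - r) ^ 3 := by
    have : 0 < 1 - r := by linarith
    positivity
  have h3 : 0 ≤ r ^ 3 := by positivity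
  have e : radiusPoly l r - radiusPoly 1 r = (1 - l) * ((1 - r) ^ 3 + 4 * r ^ 3 * (1 - l)) := by
    rw [radiusPoly, radiusPoly]; ring
  have : 0 < (1 - l) * ((1 - r) ^ 3 + 4 * r ^ 3 * (1 - l)) :=
    mul_pos (by linarith) (add_pos_of_pos_of_nonneg h2 (mul_nonneg (by linarith) (by linarith)))
  linarith

theorem refinedBohrSum_le {f g : ℂ → ℂ} {a : ℕ → ℂ} (hf : HasTaylorCoeffs f a)
    (hg : IsConvexUnivalent g) (hfg : IsSubordinate f g) {r : ℝ} (hl : boundaryDist g ≤ 1)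
    (h0 : 0 ≤ r) (h1 : r < 1) (hr : 0 ≤ radiusPoly (boundaryDist g) r) :
    refinedBohrSum a (boundaryDist g) r ≤ boundaryDist g :=
  (refinedBohrSum_le_of_norm_le (by linarith)
    (norm_coeff_le_two_mul_boundaryDist hf hg hfg) h0 h1).trans
    (mul_le_of_le_one_right infDist_nonneg
      ((halfPlaneRatio_le_one_iff (by linarith) h0 h1).2 hr))

theorem exists_lt_refinedBohrSum {l r : ℝ} (hl : 0 < l) (h0 : 0 ≤ r) (h1 : r < 1)
    (hr : 1 < halfPlaneRatio l r) :
    ∃ (f g : ℂ → ℂ) (a : ℕ → ℂ), HasTaylorCoeffs f a ∧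
      IsConvexUnivalent g ∧ IsSubordinate f g ∧ boundaryDist g = l ∧
      l < refinedBohrSum a l r := by
  refine ⟨halfPlaneMap l, halfPlaneMap l, _, hasTaylorCoeffs_halfPlaneMap l,
    isConvexUnivalent_halfPlaneMap hl, isSubordinate_refl _, boundaryDist_halfPlaneMap hl, ?_⟩
  rw [refinedBohrSum_eq_of_norm_eq (l := l) (fun n => by simp [abs_of_pos hl]) h0 h1]
  exact lt_mul_of_one_lt_right hl hr

theorem theorem2 :
    ∃ rs ∈ Ioo (0 : ℝ) 1,
      -- `rs` is the unique root in `(0, 1)` of the cubic, and `rs ≈ 0.24683`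
      (∀ r ∈ Ioo (0 : ℝ) 1, 3 * r ^ 3 - 5 * r ^ 2 - 3 * r + 1 = 0 ↔ r = rs) ∧
      |rs - 0.24683| < 0.000005 ∧
      -- the inequality for all radii up to `rs`
      (∀ (f g : ℂ → ℂ) (a : ℕ → ℂ), HasTaylorCoeffs f a → IsConvexUnivalent g →
        IsSubordinate f g → boundaryDist g ≤ 1 →
        ∀ r ∈ Icc 0 rs, refinedBohrSum a (boundaryDist g) r ≤ boundaryDist g) ∧
      -- `rs` is optimal for the whole range `boundaryDist g ≤ 1`
      (∀ r ∈ Ioo rs 1, ∃ (f g : ℂ → ℂ) (a : ℕ → ℂ), HasTaylorCoeffs f a ∧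
        IsConvexUnivalent g ∧ IsSubordinate f g ∧ boundaryDist g ≤ 1 ∧
        boundaryDist g < refinedBohrSum a (boundaryDist g) r) ∧
      -- the larger radius `r₀`, depending only on the distance `l`
      ∀ l ∈ Ioo (0 : ℝ) 1, ∃ r₀ ∈ Ioo rs (1 / 3),
        (∀ r ∈ Ioo rs (1 / 3), radiusPoly l r = 0 ↔ r = r₀) ∧
        (∀ (f g : ℂ → ℂ) (a : ℕ → ℂ), HasTaylorCoeffs f a → IsConvexUnivalent g →
          IsSubordinate f g → boundaryDist g = l →
          ∀ r ∈ Icc 0 r₀, refinedBohrSum a l r ≤ l) ∧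
        -- `r₀` is optimal for the given `l`
        (∀ r ∈ Ioo r₀ 1, ∃ (f g : ℂ → ℂ) (a : ℕ → ℂ), HasTaylorCoeffs f a ∧
          IsConvexUnivalent g ∧ IsSubordinate f g ∧ boundaryDist g = l ∧
          l < refinedBohrSum a l r) := by
  have hcont : ∀ l, Continuous (radiusPoly l) := fun l => by unfold radiusPoly; fun_prop
  -- The bracket lies within `0.000005` of `0.24683`, so locating the root also proves the numerical
  -- claim.
  have hroot : ∃ rs ∈ Ioo (0.246826 : ℝ) 0.246834, radiusPoly 1 rs = 0 :=
    intermediate_value_Ioo' (by norm_num) (hcont 1).continuousOn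
      ⟨by rw [radiusPoly_one]; norm_num, by rw [radiusPoly_one]; norm_num⟩
  obtain ⟨rs, ⟨hrs1, hrs2⟩, hrs⟩ := hroot
  have hrs0 : 0 < rs := by linarith
  have hrs3 : rs < 1 / 3 := by linarith
  have hR : ∀ l, 0 ≤ l → l ≤ 1 → ∀ x, 0 ≤ x → x < 1 → radiusPoly l x = 0 →
      halfPlaneRatio l x = 1 ∧ (∀ r, 0 ≤ r → r ≤ x → 0 ≤ radiusPoly l r) ∧
      (∀ r, x < r → r < 1 → 1 < halfPlaneRatio l r) := by
    intro l hl0 hl1 x hx0 hx1 hx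
    have h2 : l < 2 := by linarith
    have hmono := strictMonoOn_halfPlaneRatio hl0 h2
    have hone := (halfPlaneRatio_eq_one_iff h2 hx0 hx1).2 hx
    refine ⟨hone, fun r hr0 hrx => ?_, fun r hxr hr1 => ?_⟩
    · rw [← halfPlaneRatio_le_one_iff h2 hr0 (hrx.trans_lt hx1), ← hone]
      exact hmono.monotoneOn ⟨hr0, hrx.trans_lt hx1⟩ ⟨hx0, hx1⟩ hrx
    · rw [← hone]
      exact hmono ⟨hx0, hx1⟩ ⟨hx0.trans hxr.le, hr1⟩ hxr
  have huniq : ∀ l, 0 ≤ l → l ≤ 1 → ∀ x, 0 ≤ x → x < 1 → radiusPoly l x = 0 →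
      ∀ r, 0 ≤ r → r < 1 → (radiusPoly l r = 0 ↔ r = x) := by
    intro l hl0 hl1 x hx0 hx1 hx r hr0 hr1
    refine ⟨fun h => ?_, fun h => h ▸ hx⟩
    exact (strictMonoOn_halfPlaneRatio hl0 (by linarith)).injOn ⟨hr0, hr1⟩ ⟨hx0, hx1⟩
      (((hR l hl0 hl1 r hr0 hr1 h).1).trans ((hR l hl0 hl1 x hx0 hx1 hx).1).symm)
  obtain ⟨-, hle, hgt⟩ := hR 1 zero_le_one le_rfl rs hrs0.le (by linarith) hrs
  refine ⟨rs, ⟨hrs0, by linarith⟩, fun r hr => ?_, ?_, ?_, ?_, ?_⟩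
  · rw [← radiusPoly_one]
    exact huniq 1 zero_le_one le_rfl rs hrs0.le (by linarith) hrs r hr.1.le hr.2
  · rw [abs_lt]
    constructor <;> norm_num at hrs1 hrs2 ⊢ <;> linarith
  · intro f g a hf hg hfg hl r hr
    have hr1 : r < 1 := by linarith [hr.2]
    refine refinedBohrSum_le hf hg hfg hl hr.1 hr1 ?_
    rcases hl.lt_or_eq with h | h
    · exact (hle r hr.1 hr.2).trans (radiusPoly_one_lt h hr.1 hr1).le
    · rw [h]
      exact hle r hr.1 hr.2
  · intro r hr
    obtain ⟨f, g, a, h1, h2, h3, h4, h5⟩ :=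
      exists_lt_refinedBohrSum one_pos (hrs0.trans hr.1).le hr.2 (hgt r hr.1 hr.2)
    exact ⟨f, g, a, h1, h2, h3, h4.le, by rwa [h4]⟩
  · intro l hl
    have hroot : ∃ r₀ ∈ Ioo rs (1 / 3), radiusPoly l r₀ = 0 := by
      refine intermediate_value_Ioo' hrs3.le (hcont l).continuousOn ⟨?_, ?_⟩
      -- At `r = 1 / 3` the terms free of `l` cancel, leaving `4 * l * (l - 4) / 27 < 0`.
      · rw [radiusPoly]
        nlinarith [hl.1, hl.2]
      · have := radiusPoly_one_lt hl.2 hrs0.le (by linarith)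
        rwa [hrs] at this
    obtain ⟨r₀, hr₀, hz⟩ := hroot
    have h0 : 0 ≤ r₀ := (hrs0.trans hr₀.1).le
    have h1 : r₀ < 1 := by linarith [hr₀.2]
    obtain ⟨-, hle, hgt⟩ := hR l hl.1.le hl.2.le r₀ h0 h1 hz
    refine ⟨r₀, hr₀, fun r hr => ?_, ?_, fun r hr => ?_⟩
    · exact huniq l hl.1.le hl.2.le r₀ h0 h1 hz r (hrs0.trans hr.1).le (by linarith [hr.2])
    · rintro f g a hf hg hfg rfl r hr
      exact refinedBohrSum_le hf hg hfg hl.2.le hr.1 (hr.2.trans_lt h1) (hle r hr.1 hr.2)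
    · exact exists_lt_refinedBohrSum hl.1 (h0.trans hr.1.le) hr.2 (hgt r hr.1 hr.2)
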